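/- Two risk-neutral players compete for an object. Player $i\in\{1,2\}$ has a private valuation (type) $v_i\ge 0$; the types are independent, and $v_i$ has distribution function $F_i$ with a density and with support $[\underline v_i,\bar v_i]$, where $0\le\underline v_i<\bar v_i$. Player 1 first offers a bribe $b\ge 0$. If player 2 accepts, the payoffs are $v_1-b$ and $b$. If she rejects, the players take part in an all-pay auction: both submit and pay nonnegative bids, the higher bid wins the object, and ties are broken by a fair coin. For types with laws $\tilde F_1,\tilde F_2$, a Bayesian Nash equilibrium (BNE) of this auction is a pair of distributional strategies (probability measures on type-bid pairs with type marginals $\tilde F_i$) under which almost every type-bid pair of each player consists of a type and a bid maximizing that type's expected payoff against the other player's strategy; the auction value of a type is the supremum over nonnegative bids of its expected payoff against the other player's strategy. An equilibrium is a perfect Bayesian equilibrium in which bribes and acceptance decisions are pure. It consists of a bribing function and, for every bribe $b\ge0$, a set of rejecting types of player 2, a belief $\tilde F_1$ on $[\underline v_1,\bar v_1]$ about player 1, a belief $\tilde F_2$ on $[\underline v_2,\bar v_2]$ about player 2 after rejection, and a BNE of the all-pay auction with type laws $\tilde F_1,\tilde F_2$. For bribes on the path, $\tilde F_1$ is the conditional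 law of $v_1$ given the bribe and is concentrated on the types offering it; if the rejecting set has positive probability, $\tilde F_2$ is $F_2$ conditioned on that set; otherwise beliefs are arbitrary. For every $b$, rejecting types of player 2 have auction value at least $b$ and accepting types at most $b$; and no type of player 1 gains by offering another bribe, where his payoff is $v_1-b$ if $b$ is accepted and his auction value if it is rejected. An equilibrium is peaceful if the bribe is accepted with probability one, and peace is implementable if a peaceful equilibrium exists. Let $F_1^{-1}(s)=\inf\{t\in[\underline v_1,\bar v_1]:F_1(t)\ge s\}$, and let $\int_0^1 (F_1^{-1}(s))^{-1}ds\in(0,\infty]$. (i) If $\bar v_2\int_0^1 (F_1^{-1}(s))^{-1}ds\le 1$, then peace is implementable; in fact there is a peaceful equilibrium in which every type of player 1 offers the bribe $0$ and every type of player 2 accepts it. (ii) If $\bar v_2\int_0^1 (F_1^{-1}(s))^{-1}ds>1$ and $\underline v_1=0$, then peace is not implementable. -/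

import Mathlib

open MeasureTheory ProbabilityTheory Set
open scoped NNReal ENNReal

noncomputable section

namespace Bribing

/-- The law `μ` of a nonnegative valuation is an admissible prior: it has a density and its support
is the nondegenerate interval `[lo, hi]`. -/
structure IsPrior (μ : Measure ℝ) (lo hi : ℝ) : Prop where
  nonneg : 0 ≤ lo
  lt : lo < hi
  density : μ ≪ volume
  support_eq : μ.support = Icc lo hi

/-- The quantile function `F⁻¹(s) = inf {t ∈ supp F : F(t) ≥ s}`. -/
def quantile (μ : Measure ℝ) (s : ℝ) : ℝ :=
  sInf {t : ℝ | t ∈ μ.support ∧ s ≤ cdf μ t}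

/-- `∫₀¹ (F⁻¹(s))⁻¹ ds`, as an element of `[0, ∞]`. -/
def invQuantileIntegral (μ : Measure ℝ) : ℝ≥0∞ :=
  ∫⁻ s in Ioo (0 : ℝ) 1, (ENNReal.ofReal (quantile μ s))⁻¹

/-! ### All-pay auctions

A distributional strategy is a probability measure on pairs `(type, bid)`. -/

/-- Probability that a bid `β` wins against an opponent playing the distributional strategy `τ`;
ties are broken by a fair coin. -/
def winProb (τ : Measure (ℝ × ℝ)) (β : ℝ) : ℝ :=
  τ.real {p | p.2 < β} + τ.real {p | p.2 = β} / 2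

/-- Expected payoff of type `v` from bidding `β` against `τ`: the bid is paid in any case. -/
def bidPayoff (τ : Measure (ℝ × ℝ)) (v β : ℝ) : ℝ :=
  v * winProb τ β - β

/-- The supremum expected payoff of type `v` in the auction against `τ`. The supremum is over
a set bounded above by `|v|`. -/
def auctionValue (τ : Measure (ℝ × ℝ)) (v : ℝ) : ℝ :=
  ⨆ β : ℝ≥0, bidPayoff τ v (β : ℝ)

/-- `σ` is a distributional strategy for a player with type distribution `F`, and it is
a best response to `τ`: almost every type-bid pair consists of a type and an optimal bid for it. -/
structure IsBestResponse (F : Measure ℝ) (σ τ : Measure (ℝ × ℝ)) : Prop where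
  isProb : IsProbabilityMeasure σ
  marginal : σ.map Prod.fst = F
  bid_nonneg : ∀ᵐ p ∂σ, 0 ≤ p.2
  optimal : ∀ᵐ p ∂σ, ∀ β : ℝ, 0 ≤ β → bidPayoff τ p.1 β ≤ bidPayoff τ p.1 p.2

/-- Bayesian Nash equilibrium of the all-pay auction with independent types of laws `F₁`, `F₂`. -/
def IsBNE (F₁ F₂ : Measure ℝ) (σ₁ σ₂ : Measure (ℝ × ℝ)) : Prop :=
  IsBestResponse F₁ σ₁ σ₂ ∧ IsBestResponse F₂ σ₂ σ₁

/-! ### The bribing game -/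

/-- Strategies and beliefs in the bribing game. Everything after the offer depends on the
bribe `b` that was offered. -/
structure Assessment where
  /-- the bribe offered by each type of player 1 -/
  bribe : ℝ → ℝ
  /-- the types of player 2 that reject the bribe `b` -/
  reject : ℝ → Set ℝ
  /-- belief about player 1's type after the bribe `b` -/
  belief₁ : ℝ → Measure ℝ
  /-- belief about player 2's type after she rejected the bribe `b` -/
  belief₂ : ℝ → Measure ℝ
  /-- player 1's strategy in the auction after the bribe `b` is rejected -/
  bid₁ : ℝ → Measure (ℝ × ℝ)
  /-- player 2's strategy in the auction after the bribe `b` is rejected -/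
  bid₂ : ℝ → Measure (ℝ × ℝ)

/-- Expected payoff of type `v₁` of player 1 from offering `b`: he gets `v₁ - b` if `b` is
accepted, and his value in the continuation auction if it is rejected. -/
def Assessment.payoff₁ (A : Assessment) (μ₂ : Measure ℝ) (v₁ b : ℝ) : ℝ :=
  (1 - μ₂.real (A.reject b)) * (v₁ - b) + μ₂.real (A.reject b) * auctionValue (A.bid₂ b) v₁

/-- Perfect Bayesian equilibrium of the bribing game in which the types of the players are
independent with laws `μ₁` on `[lo₁, hi₁]` and `μ₂` on `[lo₂, hi₂]`. -/
structure Assessment.IsEquilibrium (A : Assessment) (μ₁ μ₂ : Measure ℝ) [IsFiniteMeasure μ₁]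
    (lo₁ hi₁ lo₂ hi₂ : ℝ) : Prop where
  bribe_measurable : Measurable A.bribe
  bribe_nonneg : ∀ v₁ ∈ Icc lo₁ hi₁, 0 ≤ A.bribe v₁
  reject_measurable : ∀ b, 0 ≤ b → MeasurableSet (A.reject b)
  /-- Beliefs about player 1 are probability laws on his type space. -/
  belief₁_prob : ∀ b, 0 ≤ b →
    IsProbabilityMeasure (A.belief₁ b) ∧ A.belief₁ b (Icc lo₁ hi₁) = 1
  /-- Bayes' rule for on-path bribes: the belief is the conditional law of player 1's type given
  the bribe, and it is concentrated on the types that offer this bribe. -/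
  belief₁_bayes : ∀ᵐ b ∂(μ₁.map A.bribe), A.belief₁ b = condDistrib id A.bribe μ₁ b
  belief₁_sender : ∀ v₁ ∈ Icc lo₁ hi₁,
    A.belief₁ (A.bribe v₁) {w | w ∈ Icc lo₁ hi₁ ∧ A.bribe w = A.bribe v₁} = 1
  /-- Beliefs about player 2 are probability laws on her type space. -/
  belief₂_prob : ∀ b, 0 ≤ b →
    IsProbabilityMeasure (A.belief₂ b) ∧ A.belief₂ b (Icc lo₂ hi₂) = 1
  /-- Bayes' rule after a rejection that has positive probability. -/
  belief₂_bayes : ∀ b, 0 ≤ b → μ₂ (A.reject b) ≠ 0 → A.belief₂ b = μ₂[|A.reject b]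
  /-- After the rejection of any bribe an equilibrium of the continuation auction is played. -/
  auction : ∀ b, 0 ≤ b → IsBNE (A.belief₁ b) (A.belief₂ b) (A.bid₁ b) (A.bid₂ b)
  /-- A type of player 2 that rejects `b` gets at least `b` in the continuation auction. -/
  reject_optimal : ∀ b, 0 ≤ b → ∀ v₂ ∈ Icc lo₂ hi₂, v₂ ∈ A.reject b →
    b ≤ auctionValue (A.bid₁ b) v₂
  /-- A type of player 2 that accepts `b` gets at most `b` in the continuation auction. -/
  accept_optimal : ∀ b, 0 ≤ b → ∀ v₂ ∈ Icc lo₂ hi₂, v₂ ∉ A.reject b →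
    auctionValue (A.bid₁ b) v₂ ≤ b
  /-- No type of player 1 gains by offering another bribe. -/
  bribe_optimal : ∀ v₁ ∈ Icc lo₁ hi₁, ∀ b, 0 ≤ b →
    A.payoff₁ μ₂ v₁ b ≤ A.payoff₁ μ₂ v₁ (A.bribe v₁)

/-- Peace occurs with probability one: almost every type of player 1 offers a bribe that almost
every type of player 2 accepts. -/
def Assessment.IsPeaceful (A : Assessment) (μ₁ μ₂ : Measure ℝ) : Prop :=
  ∀ᵐ v₁ ∂μ₁, μ₂ (A.reject (A.bribe v₁)) = 0

/-- Peace is implementable: there is a peaceful equilibrium. -/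
def PeaceImplementable (μ₁ μ₂ : Measure ℝ) [IsFiniteMeasure μ₁] (lo₁ hi₁ lo₂ hi₂ : ℝ) : Prop :=
  ∃ A : Assessment, A.IsEquilibrium μ₁ μ₂ lo₁ hi₁ lo₂ hi₂ ∧ A.IsPeaceful μ₁ μ₂

end Bribing

end

/-! In a peaceful equilibrium with `lo₁ = 0`, accepted bribes are all equal, and types near `0`
cannot afford a positive one; so almost every type offers `0`. After a rejection of `0`, player 1's
law is therefore his prior `μ₁`, and the type `hi₂` has auction value `0`: bidding just above `c` is
worthless to her, that is, `hi₂ · P(bid₁ ≤ c) ≤ c`. On the other hand, let `Φ(y)` be the auction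
value of type `1/y` of player 1 divided by `1/y`. It is a supremum of functions affine in `y` with
slope minus the bid, so types at most `1/y` bid at most `-Φ'(y)`, and hence
`hi₂ · F₁(1/y) ≤ -Φ'(y)`. Since `Φ` takes values in `[0, 1]`, integrating over `y > 0` gives
`hi₂ · E[1/v₁] ≤ 1`, and `E[1/v₁] = ∫₀¹ 1/F₁⁻¹`.

Conversely, if `hi₂ ∫₀¹ 1/F₁⁻¹ ≤ 1`, let type `F₁⁻¹(s)` of player 1 bid `hi₂ s`. His bids are then
uniform on `(0, hi₂)`, which leaves no rent to any type of player 2. They are optimal against the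
type `hi₂` mixing so that the bid `hi₂ s` has density `hi₂ / F₁⁻¹(s) ds`, and the hypothesis says
that this is a sub-probability; the missing mass bids `0`. -/

namespace Bribing

section Quantile

variable {μ : Measure ℝ} [IsProbabilityMeasure μ]

lemma exists_mem_support_cdf_eq {t : ℝ} (ht : 0 < cdf μ t) :
    ∃ x ∈ μ.support, x ≤ t ∧ cdf μ x = cdf μ t := by
  have hne : (μ.support ∩ Iic t).Nonempty := by
    refine nonempty_of_measure_ne_zero (μ := μ) ?_
    rw [inter_comm, measure_inter_conull Measure.measure_compl_support, ← ofReal_cdf]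
    exact (ENNReal.ofReal_pos.2 ht).ne'
  have hbdd : BddAbove (μ.support ∩ Iic t) := ⟨t, fun _ hx => hx.2⟩
  obtain ⟨hx, hxt⟩ := (Measure.isClosed_support.inter isClosed_Iic).csSup_mem hne hbdd
  set x := sSup (μ.support ∩ Iic t)
  have hgap : μ (Ioc x t) = 0 := measure_mono_null
    (fun y hy hys => hy.1.not_ge (le_csSup hbdd ⟨hys, hy.2⟩)) Measure.measure_compl_support
  refine ⟨x, hx, hxt, le_antisymm (monotone_cdf μ hxt) ?_⟩
  rw [← measure_cdf μ, StieltjesFunction.measure_Ioc, ENNReal.ofReal_eq_zero] at hgap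
  exact sub_nonpos.1 hgap

lemma quantile_le_iff {s t : ℝ} (hs : s ∈ Ioo 0 1) : quantile μ s ≤ t ↔ s ≤ cdf μ t := by
  have exists_mem {x : ℝ} (hx : s ≤ cdf μ x) : ∃ y ≤ x, y ∈ μ.support ∧ s ≤ cdf μ y := by
    obtain ⟨y, hy, hyx, heq⟩ := exists_mem_support_cdf_eq (hs.1.trans_le hx)
    exact ⟨y, hyx, hy, hx.trans_eq heq.symm⟩
  constructor
  · intro hq
    obtain ⟨x, hx⟩ := ((tendsto_cdf_atTop μ).eventually_const_le hs.2).exists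
    obtain ⟨x', -, hx'⟩ := exists_mem hx
    refine ge_of_tendsto
      (((cdf μ).right_continuous t).tendsto.mono_left (nhdsWithin_mono t Ioi_subset_Ici_self)) ?_
    filter_upwards [self_mem_nhdsWithin] with z hz
    obtain ⟨y, hy, hyz⟩ := exists_lt_of_csInf_lt ⟨x', hx'⟩ (hq.trans_lt hz)
    exact hy.2.trans (monotone_cdf μ hyz.le)
  · intro hst
    obtain ⟨a, ha⟩ := ((tendsto_cdf_atBot μ).eventually_lt_const hs.1).exists
    obtain ⟨y, hyt, hy⟩ := exists_mem hst
    refine (csInf_le ⟨a, fun z hz => ?_⟩ hy).trans hyt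
    exact ((monotone_cdf μ).reflect_lt (ha.trans_le hz.2)).le

lemma le_cdf_quantile {s : ℝ} (hs : s ∈ Ioo 0 1) : s ≤ cdf μ (quantile μ s) :=
  (quantile_le_iff hs).1 le_rfl

lemma monotoneOn_quantile : MonotoneOn (quantile μ) (Ioo 0 1) := fun _ hs _ ht hst =>
  (quantile_le_iff hs).2 (hst.trans (le_cdf_quantile ht))

lemma aemeasurable_quantile : AEMeasurable (quantile μ) (volume.restrict (Ioo 0 1)) :=
  aemeasurable_restrict_of_monotoneOn measurableSet_Ioo monotoneOn_quantile

variable (μ) in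
lemma map_quantile : (volume.restrict (Ioo 0 1)).map (quantile μ) = μ := by
  refine (Measure.ext_of_Iic _ _ fun t => ?_).symm
  have hset : quantile μ ⁻¹' Iic t ∩ Ioo 0 1 = Iic (cdf μ t) ∩ Ioo 0 1 :=
    Set.ext fun s => and_congr_left quantile_le_iff
  rw [Measure.map_apply_of_aemeasurable aemeasurable_quantile measurableSet_Iic,
    Measure.restrict_apply' measurableSet_Ioo, hset, ← Measure.restrict_apply measurableSet_Iic,
    Measure.restrict_congr_set Ioo_ae_eq_Ioc, Measure.restrict_apply measurableSet_Iic, inter_comm,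
    Ioc_inter_Iic, Real.volume_Ioc, min_eq_right (cdf_le_one μ t), sub_zero, ofReal_cdf]

lemma measureReal_Iio_quantile_le {s : ℝ} (hs : s ∈ Ioo 0 1) :
    μ.real (Iio (quantile μ s)) ≤ s := by
  have hsub : quantile μ ⁻¹' Iio (quantile μ s) ∩ Ioo 0 1 ⊆ Ioo 0 s := fun _ hr =>
    ⟨hr.2.1, monotoneOn_quantile.reflect_lt hr.2 hs hr.1⟩
  refine ENNReal.toReal_le_of_le_ofReal hs.1.le ?_
  calc μ (Iio (quantile μ s))
      = (volume.restrict (Ioo 0 1)).map (quantile μ) (Iio (quantile μ s)) := by rw [map_quantile]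
    _ = volume (quantile μ ⁻¹' Iio (quantile μ s) ∩ Ioo 0 1) := by
        rw [Measure.map_apply_of_aemeasurable aemeasurable_quantile measurableSet_Iio,
          Measure.restrict_apply' measurableSet_Ioo]
    _ ≤ volume (Ioo 0 s) := measure_mono hsub
    _ = ENNReal.ofReal s := by rw [Real.volume_Ioo, sub_zero]

lemma le_quantile {s t : ℝ} (hs : s ∈ Ioo 0 1) (ht : μ.real (Iio t) < s) : t ≤ quantile μ s := by
  by_contra! hlt
  refine ht.not_ge ((le_cdf_quantile (μ := μ) hs).trans ?_)
  exact (cdf_eq_real μ _).trans_le (measureReal_mono (Iic_subset_Iio.2 hlt))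

lemma invQuantileIntegral_eq_lintegral :
    invQuantileIntegral μ = ∫⁻ t, (ENNReal.ofReal t)⁻¹ ∂μ := by
  conv_rhs => rw [← map_quantile μ]
  exact (lintegral_map' (ENNReal.measurable_ofReal.inv.aemeasurable) aemeasurable_quantile).symm

lemma ae_pos_of_invQuantileIntegral_ne_top (h : invQuantileIntegral μ ≠ ∞) : ∀ᵐ t ∂μ, 0 < t := by
  rw [invQuantileIntegral_eq_lintegral] at h
  filter_upwards [ae_lt_top ENNReal.measurable_ofReal.inv h] with t ht
  exact ENNReal.ofReal_pos.1 (ENNReal.inv_lt_top.1 ht)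

end Quantile

lemma lintegral_inv_eq_lintegral_measure_Iic_inv (μ : Measure ℝ) [SFinite μ] :
    ∫⁻ t, (ENNReal.ofReal t)⁻¹ ∂μ = ∫⁻ y in Ioi 0, μ (Iic y⁻¹) := by
  have hmeas : MeasurableSet {p : ℝ × ℝ | p.1 ≤ p.2⁻¹} :=
    measurableSet_le measurable_fst measurable_snd.inv
  have hslice (t : ℝ) : volume.restrict (Ioi 0) {y | t ≤ y⁻¹} = (ENNReal.ofReal t)⁻¹ := by
    rw [Measure.restrict_apply' measurableSet_Ioi]
    rcases le_or_gt t 0 with ht | ht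
    · have hset : {y | t ≤ y⁻¹} ∩ Ioi 0 = Ioi 0 :=
        inter_eq_right.2 fun y hy => ht.trans (inv_nonneg.2 (le_of_lt hy))
      rw [hset, Real.volume_Ioi, ENNReal.ofReal_of_nonpos ht, ENNReal.inv_zero]
    · have hset : {y | t ≤ y⁻¹} ∩ Ioi 0 = Ioc 0 t⁻¹ := by
        ext y
        exact and_comm.trans (and_congr_right fun hy => le_inv_comm₀ ht hy)
      rw [hset, Real.volume_Ioc, sub_zero, ENNReal.ofReal_inv_of_pos ht]
  calc ∫⁻ t, (ENNReal.ofReal t)⁻¹ ∂μ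
      = μ.prod (volume.restrict (Ioi 0)) {p | p.1 ≤ p.2⁻¹} := by
        rw [Measure.prod_apply hmeas]
        exact lintegral_congr fun t => (hslice t).symm
    _ = ∫⁻ y in Ioi 0, μ (Iic y⁻¹) := Measure.prod_apply_symm hmeas

lemma lintegral_Ioi_deriv_le {f : ℝ → ℝ} {a C : ℝ} (hf : MonotoneOn f (Ici a))
    (hC : ∀ y, a ≤ y → f y - f a ≤ C) :
    ∫⁻ y in Ioi a, ENNReal.ofReal (deriv f y) ≤ ENNReal.ofReal C := by
  have hbound (n : ℕ) : ∫⁻ y in Ioc a n, ENNReal.ofReal (deriv f y) ≤ ENNReal.ofReal C := by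
    rcases lt_or_ge (n : ℝ) a with hn | hn
    · simp [Ioc_eq_empty_of_le hn.le]
    have hmono : MonotoneOn f (uIcc a n) := hf.mono (uIcc_of_le hn ▸ Icc_subset_Ici_self)
    have hint := (intervalIntegrable_iff_integrableOn_Ioc_of_le hn).1 hmono.intervalIntegrable_deriv
    have hpos : 0 ≤ᵐ[volume.restrict (Ioc a n)] deriv f :=
      ae_restrict_of_forall_mem measurableSet_Ioc fun y hy =>
        derivWithin_of_mem_nhds (f := f) (Ici_mem_nhds hy.1) ▸ hf.derivWithin_nonneg
    have hle := hmono.intervalIntegral_deriv_mem_uIcc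
    rw [uIcc_of_le (sub_nonneg.2 (hf self_mem_Ici hn hn)),
      intervalIntegral.integral_of_le hn] at hle
    rw [← ofReal_integral_eq_lintegral_ofReal hint hpos]
    exact ENNReal.ofReal_le_ofReal (hle.2.trans (hC n hn))
  rw [← iUnion_Ioc_eq_Ioi_self_iff.2 fun x _ => exists_nat_ge x, setLIntegral_iUnion_of_directed]
  · exact iSup_le hbound
  · exact Monotone.directed_le fun m n hmn => Ioc_subset_Ioc_right (Nat.cast_le.2 hmn)

lemma lintegral_Ioi_le_of_mul_sub_le {f g : ℝ → ℝ} {a C : ℝ} (hf : MonotoneOn f (Ici a))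
    (hC : ∀ y, a ≤ y → f y - f a ≤ C)
    (hg : ∀ x y, a ≤ x → x < y → g y * (y - x) ≤ f y - f x) :
    ∫⁻ y in Ioi a, ENNReal.ofReal (g y) ≤ ENNReal.ofReal C := by
  refine le_trans (setLIntegral_mono_ae' measurableSet_Ioi ?_) (lintegral_Ioi_deriv_le hf hC)
  filter_upwards [hf.ae_differentiableWithinAt_of_mem] with y hdiff hy
  have hd := ((hdiff (Ioi_subset_Ici_self hy)).differentiableAt (Ici_mem_nhds hy)).hasDerivAt
  refine ENNReal.ofReal_le_ofReal <|
    ge_of_tendsto (hasDerivAt_iff_tendsto_slope_left_right.1 hd).1 ?_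
  filter_upwards [Ioo_mem_nhdsLT hy] with x hx
  rw [slope_comm, slope_def_field, le_div_iff₀ (sub_pos.2 hx.2)]
  exact hg x y hx.1.le hx.2

section Auction

lemma winProb_nonneg (τ : Measure (ℝ × ℝ)) (β : ℝ) : 0 ≤ winProb τ β :=
  add_nonneg measureReal_nonneg (div_nonneg measureReal_nonneg zero_le_two)

lemma winProb_eq_real_map_snd (τ : Measure (ℝ × ℝ)) (β : ℝ) :
    winProb τ β = (τ.map Prod.snd).real (Iio β) + (τ.map Prod.snd).real {β} / 2 := by
  rw [map_measureReal_apply measurable_snd measurableSet_Iio,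
    map_measureReal_apply measurable_snd (measurableSet_singleton β)]
  rfl

lemma real_Iio_le_winProb (τ : Measure (ℝ × ℝ)) (β : ℝ) :
    (τ.map Prod.snd).real (Iio β) ≤ winProb τ β := by
  rw [winProb_eq_real_map_snd]
  exact le_add_of_nonneg_right (div_nonneg measureReal_nonneg zero_le_two)

section IsFiniteMeasure

variable (τ : Measure (ℝ × ℝ)) [IsFiniteMeasure τ]

lemma winProb_le_real_Iic (β : ℝ) : winProb τ β ≤ (τ.map Prod.snd).real (Iic β) := by
  rw [winProb_eq_real_map_snd, ← Iio_union_right,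
    measureReal_union (disjoint_singleton_right.2 self_notMem_Iio) (measurableSet_singleton β)]
  exact add_le_add_right (half_le_self measureReal_nonneg) _

variable {τ} in
lemma real_Ioo_le_winProb_sub {β x : ℝ} (h : β < x) :
    (τ.map Prod.snd).real (Ioo β x) ≤ winProb τ x - winProb τ β := by
  have hsplit : (τ.map Prod.snd).real (Iio x)
      = (τ.map Prod.snd).real (Iic β) + (τ.map Prod.snd).real (Ioo β x) := by
    rw [← Iic_union_Ioo_eq_Iio h, measureReal_union
      ((Iic_disjoint_Ioi le_rfl).mono_right Ioo_subset_Ioi_self) measurableSet_Ioo]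
  linarith [real_Iio_le_winProb τ x, winProb_le_real_Iic τ β]

variable {τ} in
lemma winProb_sub_le_real_Icc {x β : ℝ} (h : x ≤ β) :
    winProb τ β - winProb τ x ≤ (τ.map Prod.snd).real (Icc x β) := by
  have hsplit : (τ.map Prod.snd).real (Iic β)
      = (τ.map Prod.snd).real (Iio x) + (τ.map Prod.snd).real (Icc x β) := by
    rw [← Iio_union_Icc_eq_Iic h, measureReal_union
      ((Iio_disjoint_Ici le_rfl).mono_right Icc_subset_Ici_self) measurableSet_Icc]
  linarith [real_Iio_le_winProb τ x, winProb_le_real_Iic τ β]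

lemma monotone_winProb : Monotone (winProb τ) :=
  monotone_iff_forall_lt.2 fun _ _ h =>
    sub_nonneg.1 (measureReal_nonneg.trans (real_Ioo_le_winProb_sub h))

end IsFiniteMeasure

variable (τ : Measure (ℝ × ℝ)) [IsProbabilityMeasure τ]

lemma winProb_le_one (β : ℝ) : winProb τ β ≤ 1 := by
  have := Measure.isProbabilityMeasure_map (μ := τ) measurable_snd.aemeasurable
  exact (winProb_le_real_Iic τ β).trans measureReal_le_one

lemma bidPayoff_le_abs (v : ℝ) {β : ℝ} (hβ : 0 ≤ β) : bidPayoff τ v β ≤ |v| := calc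
  v * winProb τ β - β ≤ v * winProb τ β := sub_le_self _ hβ
  _ ≤ |v| * winProb τ β := mul_le_mul_of_nonneg_right (le_abs_self v) (winProb_nonneg τ β)
  _ ≤ |v| := mul_le_of_le_one_right (abs_nonneg v) (winProb_le_one τ β)

lemma bidPayoff_le_auctionValue (v : ℝ) {β : ℝ} (hβ : 0 ≤ β) :
    bidPayoff τ v β ≤ auctionValue τ v :=
  le_ciSup (f := fun β : ℝ≥0 => bidPayoff τ v β)
    ⟨|v|, forall_mem_range.2 fun x => bidPayoff_le_abs τ v x.2⟩ ⟨β, hβ⟩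

lemma auctionValue_nonneg {v : ℝ} (hv : 0 ≤ v) : 0 ≤ auctionValue τ v :=
  calc 0 ≤ bidPayoff τ v 0 := by
        rw [bidPayoff, sub_zero]
        exact mul_nonneg hv (winProb_nonneg τ 0)
    _ ≤ auctionValue τ v := bidPayoff_le_auctionValue τ v le_rfl

lemma continuous_auctionValue : Continuous (auctionValue τ) := by
  refine (LipschitzWith.of_le_add fun v w => ciSup_le fun β => ?_).continuous
  have hdiff : (v - w) * winProb τ β ≤ dist v w := calc
    (v - w) * winProb τ β ≤ |v - w| * winProb τ β :=
      mul_le_mul_of_nonneg_right (le_abs_self _) (winProb_nonneg τ β)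
    _ ≤ |v - w| := mul_le_of_le_one_right (abs_nonneg _) (winProb_le_one τ β)
  calc bidPayoff τ v β = bidPayoff τ w β + (v - w) * winProb τ β := by unfold bidPayoff; ring
    _ ≤ auctionValue τ w + dist v w := add_le_add (bidPayoff_le_auctionValue τ w β.2) hdiff

lemma mul_real_Iic_le_of_auctionValue_nonpos {v c : ℝ} (hval : auctionValue τ v ≤ 0)
    (hv : 0 ≤ v) (hc : 0 ≤ c) : v * (τ.map Prod.snd).real (Iic c) ≤ c := by
  have hwin {β : ℝ} (hβ : 0 ≤ β) : v * winProb τ β ≤ β :=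
    sub_nonpos.1 ((bidPayoff_le_auctionValue τ v hβ).trans hval)
  -- Bidding slightly above `c` avoids sharing the ties at `c`.
  refine le_of_forall_gt_imp_ge_of_dense fun a ha => ?_
  refine le_trans (mul_le_mul_of_nonneg_left ?_ hv) (hwin (hc.trans ha.le))
  exact (measureReal_mono (Iic_subset_Iio.2 ha)).trans (real_Iio_le_winProb τ a)

end Auction

/-- The auction value per unit of valuation, as a function of the inverse valuation `y`: type `t`
has auction value `t * scaledValue τ t⁻¹`. This normalization makes it a supremum of functions
that are affine in `y` with slope minus the bid, so its slopes bound optimal bids. -/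
noncomputable def scaledValue (τ : Measure (ℝ × ℝ)) (y : ℝ) : ℝ :=
  ⨆ β : ℝ≥0, (winProb τ β - β * y)

section ScaledValue

variable (τ : Measure (ℝ × ℝ)) [IsProbabilityMeasure τ]

lemma winProb_sub_mul_le_one {y β : ℝ} (hy : 0 ≤ y) (hβ : 0 ≤ β) : winProb τ β - β * y ≤ 1 :=
  (sub_le_self _ (mul_nonneg hβ hy)).trans (winProb_le_one τ β)

lemma le_scaledValue {y β : ℝ} (hy : 0 ≤ y) (hβ : 0 ≤ β) :
    winProb τ β - β * y ≤ scaledValue τ y :=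
  le_ciSup (f := fun β : ℝ≥0 => winProb τ β - β * y)
    ⟨1, forall_mem_range.2 fun x => winProb_sub_mul_le_one τ hy x.2⟩ ⟨β, hβ⟩

lemma scaledValue_le_one {y : ℝ} (hy : 0 ≤ y) : scaledValue τ y ≤ 1 :=
  ciSup_le fun β => winProb_sub_mul_le_one τ hy β.2

lemma scaledValue_nonneg {y : ℝ} (hy : 0 ≤ y) : 0 ≤ scaledValue τ y :=
  calc 0 ≤ winProb τ 0 - 0 * y := by rw [zero_mul, sub_zero]; exact winProb_nonneg τ 0
    _ ≤ scaledValue τ y := le_scaledValue τ hy le_rfl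

lemma antitoneOn_scaledValue : AntitoneOn (scaledValue τ) (Ici 0) := fun _ hy _ _ hyy' =>
  ciSup_le fun β => (sub_le_sub_left (mul_le_mul_of_nonneg_left hyy' β.2) _).trans
    (le_scaledValue τ hy β.2)

variable {τ} in
lemma scaledValue_add_mul_sub_le {y y' t x : ℝ} (hy : 0 ≤ y) (hyy' : y ≤ y') (hty' : t * y' ≤ 1)
    (hx : 0 ≤ x) (hopt : ∀ β : ℝ, 0 ≤ β → bidPayoff τ t β ≤ bidPayoff τ t x) :
    scaledValue τ y' + x * (y' - y) ≤ scaledValue τ y := by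
  refine le_sub_iff_add_le.1 (ciSup_le fun β => ?_)
  rcases le_total x β with hxβ | hβx
  · have hslope : x * (y' - y) ≤ β * (y' - y) :=
      mul_le_mul_of_nonneg_right hxβ (sub_nonneg.2 hyy')
    have hvalue : winProb τ β - β * y ≤ scaledValue τ y := le_scaledValue τ hy β.2
    linarith
  -- Raising the bid from `β` to `x` pays for type `t`, hence for the higher type `1 / y'`.
  · have hgain : 0 ≤ winProb τ x - winProb τ β := sub_nonneg.2 (monotone_winProb τ hβx)
    have hcost : x - β ≤ t * (winProb τ x - winProb τ β) := by
      have := hopt β β.2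
      unfold bidPayoff at this
      linarith
    have hscaled : (x - β) * y' ≤ winProb τ x - winProb τ β := calc
      (x - β) * y' ≤ t * (winProb τ x - winProb τ β) * y' :=
        mul_le_mul_of_nonneg_right hcost (hy.trans hyy')
      _ = t * y' * (winProb τ x - winProb τ β) := by ring
      _ ≤ winProb τ x - winProb τ β := mul_le_of_le_one_left hgain hty'
    linarith [le_scaledValue τ hy hx]

end ScaledValue

section Necessity

variable {μ : Measure ℝ} {σ τ : Measure (ℝ × ℝ)} [IsProbabilityMeasure τ] {v : ℝ}

lemma IsBestResponse.mul_real_Iic_inv_mul_sub_le (hσ : IsBestResponse μ σ τ) (hv : 0 ≤ v)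
    (hval : auctionValue σ v ≤ 0) {y y' : ℝ} (hy : 0 ≤ y) (hyy' : y < y') :
    v * μ.real (Iic y'⁻¹) * (y' - y) ≤ scaledValue τ y - scaledValue τ y' := by
  have := hσ.isProb
  have hd : 0 < y' - y := sub_pos.2 hyy'
  rw [← le_div_iff₀ hd]
  set c := (scaledValue τ y - scaledValue τ y') / (y' - y)
  have hbid : ∀ᵐ p ∂σ, p.1 ≤ y'⁻¹ → p.2 ≤ c := by
    filter_upwards [hσ.bid_nonneg, hσ.optimal] with p hbid hopt htype
    have hty' : p.1 * y' ≤ 1 := (le_div_iff₀ (hy.trans_lt hyy')).1 (htype.trans_eq (one_div _).symm)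
    exact (le_div_iff₀ hd).2
      (le_sub_iff_add_le'.2 (scaledValue_add_mul_sub_le hy hyy'.le hty' hbid hopt))
  have hc : 0 ≤ c := div_nonneg
    (sub_nonneg.2 (antitoneOn_scaledValue τ hy (hy.trans hyy'.le) hyy'.le)) hd.le
  calc v * μ.real (Iic y'⁻¹)
      = v * σ.real {p | p.1 ≤ y'⁻¹} := by
        rw [← hσ.marginal, map_measureReal_apply measurable_fst measurableSet_Iic]
        rfl
    _ ≤ v * σ.real {p | p.2 ≤ c} :=
        mul_le_mul_of_nonneg_left
          (ENNReal.toReal_mono (measure_ne_top _ _) (measure_mono_ae hbid)) hv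
    _ = v * (σ.map Prod.snd).real (Iic c) := by
        rw [map_measureReal_apply measurable_snd measurableSet_Iic]
        rfl
    _ ≤ c := mul_real_Iic_le_of_auctionValue_nonpos σ hval hv hc

theorem IsBestResponse.mul_invQuantileIntegral_le_one [IsProbabilityMeasure μ]
    (hσ : IsBestResponse μ σ τ) (hv : 0 ≤ v) (hval : auctionValue σ v ≤ 0) :
    ENNReal.ofReal v * invQuantileIntegral μ ≤ 1 := by
  calc ENNReal.ofReal v * invQuantileIntegral μ
      = ∫⁻ y in Ioi 0, ENNReal.ofReal (v * μ.real (Iic y⁻¹)) := by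
        rw [invQuantileIntegral_eq_lintegral, lintegral_inv_eq_lintegral_measure_Iic_inv,
          ← lintegral_const_mul' _ _ ENNReal.ofReal_ne_top]
        exact lintegral_congr fun y => by rw [ENNReal.ofReal_mul hv, ofReal_measureReal]
    _ ≤ ENNReal.ofReal 1 := by
        refine lintegral_Ioi_le_of_mul_sub_le (f := fun y => -scaledValue τ y)
          (antitoneOn_scaledValue τ).neg (fun y hy => ?_) fun x y hx hxy => ?_
        · linarith [scaledValue_le_one τ le_rfl, scaledValue_nonneg τ hy]
        · linarith [hσ.mul_real_Iic_inv_mul_sub_le hv hval hx hxy]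
    _ = 1 := ENNReal.ofReal_one

end Necessity

lemma condDistrib_eq_map_of_ae_eq_const {Ω α β : Type*} {mΩ : MeasurableSpace Ω}
    [MeasurableSpace α] [StandardBorelSpace α] [Nonempty α]
    [MeasurableSpace β] [MeasurableSingletonClass β] {μ : Measure Ω} [IsProbabilityMeasure μ]
    {X : Ω → β} {Y : Ω → α} {c : β} (hY : AEMeasurable Y μ) (hX : X =ᵐ[μ] fun _ => c) :
    condDistrib Y X μ c = μ.map Y := by
  have h : condDistrib Y (fun _ => c) μ =ᵐ[μ.map fun _ => c] Kernel.const β (μ.map Y) := by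
    refine condDistrib_ae_eq_of_measure_eq_compProd _ hY ?_
    have := Measure.isProbabilityMeasure_map hY
    rw [Measure.map_const, measure_univ, one_smul, Measure.compProd_const, Measure.dirac_prod,
      AEMeasurable.map_map_of_aemeasurable (by fun_prop) hY]
    rfl
  rw [Measure.map_const, measure_univ, one_smul, Filter.EventuallyEq, ae_dirac_eq] at h
  rw [condDistrib_congr_right hX]
  exact Filter.eventually_pure.1 h

section Peaceful

variable {A : Assessment} {μ₁ μ₂ : Measure ℝ} {hi₁ lo₂ hi₂ v w b : ℝ}

lemma Assessment.payoff₁_of_reject_null (h : μ₂ (A.reject b) = 0) :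
    A.payoff₁ μ₂ v b = v - b := by
  rw [Assessment.payoff₁, measureReal_def, h, ENNReal.toReal_zero, sub_zero, one_mul, zero_mul,
    add_zero]

lemma Assessment.payoff₁_nonneg [IsProbabilityMeasure μ₂] [IsProbabilityMeasure (A.bid₂ b)]
    (hv : 0 ≤ v) (hb : b ≤ v) : 0 ≤ A.payoff₁ μ₂ v b :=
  add_nonneg (mul_nonneg (sub_nonneg.2 measureReal_le_one) (sub_nonneg.2 hb))
    (mul_nonneg measureReal_nonneg (auctionValue_nonneg _ hv))

lemma Assessment.IsPeaceful.reject_zero_null [NeZero μ₁] (hpeace : A.IsPeaceful μ₁ μ₂)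
    (hbribe : A.bribe =ᵐ[μ₁] fun _ => 0) : μ₂ (A.reject 0) = 0 := by
  obtain ⟨v, hacc, hv⟩ := (hpeace.and hbribe).exists
  rwa [hv] at hacc

namespace Assessment.IsEquilibrium

variable [IsProbabilityMeasure μ₁]

lemma bribe_le_self [IsProbabilityMeasure μ₂] (hA : A.IsEquilibrium μ₁ μ₂ 0 hi₁ lo₂ hi₂)
    (hv : v ∈ Icc 0 hi₁) (hacc : μ₂ (A.reject (A.bribe v)) = 0) : A.bribe v ≤ v := by
  have := (hA.auction 0 le_rfl).2.isProb
  have hdev : A.payoff₁ μ₂ v 0 ≤ v - A.bribe v :=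
    payoff₁_of_reject_null hacc ▸ hA.bribe_optimal v hv 0 le_rfl
  exact sub_nonneg.1 ((payoff₁_nonneg hv.1 hv.1).trans hdev)

lemma bribe_le_bribe {lo₁ : ℝ} (hA : A.IsEquilibrium μ₁ μ₂ lo₁ hi₁ lo₂ hi₂)
    (hv : v ∈ Icc lo₁ hi₁) (hw : w ∈ Icc lo₁ hi₁) (hvacc : μ₂ (A.reject (A.bribe v)) = 0)
    (hwacc : μ₂ (A.reject (A.bribe w)) = 0) : A.bribe v ≤ A.bribe w := by
  have hdev := hA.bribe_optimal v hv (A.bribe w) (hA.bribe_nonneg w hw)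
  rw [payoff₁_of_reject_null hvacc, payoff₁_of_reject_null hwacc] at hdev
  exact (sub_le_sub_iff_left v).1 hdev

lemma ae_bribe_eq_zero [IsProbabilityMeasure μ₂] (hA : A.IsEquilibrium μ₁ μ₂ 0 hi₁ lo₂ hi₂)
    (hpeace : A.IsPeaceful μ₁ μ₂) (h₁ : μ₁.support ⊆ Icc 0 hi₁) (h0 : 0 ∈ μ₁.support) :
    A.bribe =ᵐ[μ₁] fun _ => 0 := by
  have htype : ∀ᵐ v ∂μ₁, v ∈ Icc 0 hi₁ := Filter.mem_of_superset Measure.support_mem_ae h₁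
  filter_upwards [htype, hpeace] with v hv hvacc
  refine le_antisymm (le_of_forall_pos_le_add fun ε hε => ?_) (hA.bribe_nonneg v hv)
  have hlow : 0 < μ₁ (Iio ε) := (Measure.mem_support_iff_forall 0).1 h0 _ (Iio_mem_nhds hε)
  obtain ⟨w, hwε, hw, hwacc⟩ :=
    ((frequently_ae_mem_iff.2 hlow.ne').and_eventually (htype.and hpeace)).exists
  calc A.bribe v ≤ A.bribe w := hA.bribe_le_bribe hv hw hvacc hwacc
    _ ≤ w := hA.bribe_le_self hw hwacc
    _ ≤ 0 + ε := (zero_add ε).symm ▸ le_of_lt hwε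

lemma belief₁_zero {lo₁ : ℝ} (hA : A.IsEquilibrium μ₁ μ₂ lo₁ hi₁ lo₂ hi₂)
    (hbribe : A.bribe =ᵐ[μ₁] fun _ => 0) : A.belief₁ 0 = μ₁ := by
  have hbayes := hA.belief₁_bayes
  rw [Measure.map_congr hbribe, Measure.map_const, measure_univ, one_smul, ae_dirac_eq] at hbayes
  calc A.belief₁ 0 = condDistrib id A.bribe μ₁ 0 := Filter.eventually_pure.1 hbayes
    _ = μ₁ := (condDistrib_eq_map_of_ae_eq_const aemeasurable_id hbribe).trans Measure.map_id

lemma auctionValue_hi_nonpos {lo₁ : ℝ} (hA : A.IsEquilibrium μ₁ μ₂ lo₁ hi₁ lo₂ hi₂)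
    (h₂ : μ₂.support ⊆ Icc lo₂ hi₂) (hhi₂ : hi₂ ∈ μ₂.support) (hacc : μ₂ (A.reject 0) = 0) :
    auctionValue (A.bid₁ 0) hi₂ ≤ 0 := by
  have := (hA.auction 0 le_rfl).1.isProb
  have hclosed : IsClosed {w | auctionValue (A.bid₁ 0) w ≤ 0} :=
    isClosed_le (continuous_auctionValue _) continuous_const
  refine Measure.support_subset_of_isClosed hclosed ?_ hhi₂
  filter_upwards [Measure.support_mem_ae, compl_mem_ae_iff.2 hacc] with w hw hwacc
  exact hA.accept_optimal 0 le_rfl w (h₂ hw) hwacc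

end Assessment.IsEquilibrium

theorem PeaceImplementable.mul_invQuantileIntegral_le_one [IsProbabilityMeasure μ₁]
    [IsProbabilityMeasure μ₂] (hP : PeaceImplementable μ₁ μ₂ 0 hi₁ lo₂ hi₂)
    (h₁ : μ₁.support ⊆ Icc 0 hi₁) (h0 : 0 ∈ μ₁.support) (h₂ : μ₂.support ⊆ Icc lo₂ hi₂)
    (hhi₂ : hi₂ ∈ μ₂.support) (hpos : 0 ≤ hi₂) :
    ENNReal.ofReal hi₂ * invQuantileIntegral μ₁ ≤ 1 := by
  obtain ⟨A, hA, hpeace⟩ := hP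
  have hbribe := hA.ae_bribe_eq_zero hpeace h₁ h0
  have hval := hA.auctionValue_hi_nonpos h₂ hhi₂ (hpeace.reject_zero_null hbribe)
  obtain ⟨hbr₁, hbr₂⟩ := hA.auction 0 le_rfl
  have := hbr₂.isProb
  rw [hA.belief₁_zero hbribe] at hbr₁
  exact hbr₁.mul_invQuantileIntegral_le_one hpos hval

end Peaceful

/-- The strategy of player 1 in which type `F⁻¹(s)` bids `v s`, for `s` uniform on `(0, 1)`. It
makes the bids uniform on `(0, v)`, and amounts to the bid `v F(t)` of type `t` off the atoms of
`μ`. -/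
noncomputable def quantileStrategy (μ : Measure ℝ) (v : ℝ) : Measure (ℝ × ℝ) :=
  (volume.restrict (Ioo 0 1)).map fun s => (quantile μ s, v * s)

/-- The bid law of player 2 that makes bidding `v s` optimal for type `F⁻¹(s)` of player 1: the bid
`v s` has density `v (F⁻¹(s))⁻¹ ds`, and the remaining mass is an atom at `0`. -/
noncomputable def rivalBidLaw (μ : Measure ℝ) (v : ℝ) : Measure ℝ :=
  (1 - ENNReal.ofReal v * invQuantileIntegral μ) • Measure.dirac 0 +
    ENNReal.ofReal v • (((volume.restrict (Ioo 0 1)).withDensity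
      fun s => (ENNReal.ofReal (quantile μ s))⁻¹).map (v * ·))

section QuantileStrategy

variable (μ : Measure ℝ) [IsProbabilityMeasure μ] (v : ℝ)

lemma aemeasurable_quantile_prodMk_mul :
    AEMeasurable (fun s => (quantile μ s, v * s)) (volume.restrict (Ioo 0 1)) :=
  aemeasurable_quantile.prodMk (measurable_const_mul v).aemeasurable

instance : IsProbabilityMeasure (quantileStrategy μ v) := by
  have : IsProbabilityMeasure (volume.restrict (Ioo (0 : ℝ) 1)) := ⟨by simp⟩
  exact Measure.isProbabilityMeasure_map (aemeasurable_quantile_prodMk_mul μ v)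

lemma map_fst_quantileStrategy : (quantileStrategy μ v).map Prod.fst = μ := by
  rw [quantileStrategy, AEMeasurable.map_map_of_aemeasurable measurable_fst.aemeasurable
    (aemeasurable_quantile_prodMk_mul μ v)]
  exact map_quantile μ

lemma map_snd_quantileStrategy :
    (quantileStrategy μ v).map Prod.snd = (volume.restrict (Ioo 0 1)).map (v * ·) :=
  AEMeasurable.map_map_of_aemeasurable measurable_snd.aemeasurable
    (aemeasurable_quantile_prodMk_mul μ v)

variable {μ v}

lemma real_map_snd_quantileStrategy {s : Set ℝ} (hs : MeasurableSet s) :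
    ((quantileStrategy μ v).map Prod.snd).real s = volume.real ((v * ·) ⁻¹' s ∩ Ioo 0 1) := by
  rw [map_snd_quantileStrategy, map_measureReal_apply (measurable_const_mul v) hs,
    measureReal_restrict_apply' measurableSet_Ioo]

lemma mul_winProb_quantileStrategy_le (hv : 0 < v) {β : ℝ} (hβ : 0 ≤ β) :
    v * winProb (quantileStrategy μ v) β ≤ β := by
  have hsub : (v * ·) ⁻¹' Iic β ∩ Ioo 0 1 ⊆ Ioc 0 (β / v) := fun s hs =>
    ⟨hs.2.1, (le_div_iff₀' hv).2 hs.1⟩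
  rw [← le_div_iff₀' hv]
  calc winProb (quantileStrategy μ v) β
      ≤ volume.real ((v * ·) ⁻¹' Iic β ∩ Ioo 0 1) :=
        (winProb_le_real_Iic _ β).trans_eq (real_map_snd_quantileStrategy measurableSet_Iic)
    _ ≤ volume.real (Ioc 0 (β / v)) := measureReal_mono hsub measure_Ioc_lt_top.ne
    _ = β / v := by rw [Real.volume_real_Ioc_of_le (div_nonneg hβ hv.le), sub_zero]

lemma mul_winProb_quantileStrategy (hv : 0 < v) {β : ℝ} (hβ : β ∈ Icc 0 v) :
    v * winProb (quantileStrategy μ v) β = β := by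
  refine le_antisymm (mul_winProb_quantileStrategy_le hv hβ.1) ?_
  have hsub : Ioo 0 (β / v) ⊆ (v * ·) ⁻¹' Iio β ∩ Ioo 0 1 := fun s hs =>
    ⟨(lt_div_iff₀' hv).1 hs.2, hs.1, hs.2.trans_le ((div_le_one hv).2 hβ.2)⟩
  rw [← div_le_iff₀' hv]
  calc β / v = volume.real (Ioo 0 (β / v)) := by
        rw [Real.volume_real_Ioo_of_le (div_nonneg hβ.1 hv.le), sub_zero]
    _ ≤ volume.real ((v * ·) ⁻¹' Iio β ∩ Ioo 0 1) :=
        measureReal_mono hsub ((measure_mono inter_subset_right).trans_lt measure_Ioo_lt_top).ne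
    _ ≤ winProb (quantileStrategy μ v) β :=
        (real_map_snd_quantileStrategy measurableSet_Iio).symm.trans_le (real_Iio_le_winProb _ β)

lemma auctionValue_quantileStrategy_nonpos (hv : 0 < v) {w : ℝ} (hw : w ≤ v) :
    auctionValue (quantileStrategy μ v) w ≤ 0 :=
  ciSup_le fun β => sub_nonpos.2 <|
    (mul_le_mul_of_nonneg_right hw (winProb_nonneg _ _)).trans
      (mul_winProb_quantileStrategy_le hv β.2)

lemma ae_quantileStrategy_bid_mem (hv : 0 < v) : ∀ᵐ p ∂quantileStrategy μ v,
    0 < p.2 ∧ p.2 ∈ Icc (v * μ.real (Iio p.1)) (v * cdf μ p.1) := by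
  have hmono : Monotone fun t => μ.real (Iio t) := fun _ _ h => measureReal_mono (Iio_subset_Iio h)
  have hmeas : MeasurableSet {p : ℝ × ℝ |
      0 < p.2 ∧ p.2 ∈ Icc (v * μ.real (Iio p.1)) (v * cdf μ p.1)} :=
    (measurableSet_lt measurable_const measurable_snd).inter <|
      (measurableSet_le ((hmono.measurable.comp measurable_fst).const_mul v) measurable_snd).inter
        (measurableSet_le measurable_snd
          (((monotone_cdf μ).measurable.comp measurable_fst).const_mul v))
  refine (ae_map_iff (aemeasurable_quantile_prodMk_mul μ v) hmeas).2 ?_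
  refine ae_restrict_of_forall_mem measurableSet_Ioo fun s hs => ⟨mul_pos hv hs.1, ?_, ?_⟩
  · exact mul_le_mul_of_nonneg_left (measureReal_Iio_quantile_le hs) hv.le
  · exact mul_le_mul_of_nonneg_left (le_cdf_quantile hs) hv.le

end QuantileStrategy

section RivalBidLaw

variable {μ : Measure ℝ} {v t x β : ℝ}

lemma rivalBidLaw_apply {s : Set ℝ} (hs : MeasurableSet s) :
    rivalBidLaw μ v s = (1 - ENNReal.ofReal v * invQuantileIntegral μ) * s.indicator 1 0 +
      ENNReal.ofReal v * ∫⁻ u in (v * ·) ⁻¹' s ∩ Ioo 0 1, (ENNReal.ofReal (quantile μ u))⁻¹ := by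
  have hm : Measurable (v * · : ℝ → ℝ) := measurable_const_mul v
  rw [rivalBidLaw, Measure.add_apply, Measure.smul_apply, Measure.smul_apply,
    Measure.dirac_apply' _ hs, Measure.map_apply hm hs, withDensity_apply _ (hm hs),
    Measure.restrict_restrict (hm hs), smul_eq_mul, smul_eq_mul]

lemma isProbabilityMeasure_rivalBidLaw (hI : ENNReal.ofReal v * invQuantileIntegral μ ≤ 1) :
    IsProbabilityMeasure (rivalBidLaw μ v) := by
  refine ⟨?_⟩
  rw [rivalBidLaw_apply MeasurableSet.univ, preimage_univ, univ_inter, indicator_univ,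
    Pi.one_apply, mul_one]
  exact tsub_add_cancel_of_le hI

lemma ae_rivalBidLaw_mem_Icc (hv : 0 ≤ v) : ∀ᵐ x ∂rivalBidLaw μ v, x ∈ Icc 0 v := by
  have hempty : (v * ·) ⁻¹' (Icc 0 v)ᶜ ∩ Ioo (0 : ℝ) 1 = ∅ := by
    refine eq_empty_of_forall_notMem fun u hu => hu.1 ⟨mul_nonneg hv hu.2.1.le, ?_⟩
    exact mul_le_of_le_one_right hv hu.2.2.le
  change rivalBidLaw μ v (Icc 0 v)ᶜ = 0
  rw [rivalBidLaw_apply measurableSet_Icc.compl, hempty,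
    indicator_of_notMem (notMem_compl_iff.2 (left_mem_Icc.2 hv)), Measure.restrict_empty,
    lintegral_zero_measure, mul_zero, mul_zero, add_zero]

lemma ofReal_mul_ofReal_inv_mul_div_sub_div (hv : 0 < v) (ht : 0 < t) :
    ENNReal.ofReal v * ((ENNReal.ofReal t)⁻¹ * ENNReal.ofReal (x / v - β / v)) =
      ENNReal.ofReal ((x - β) / t) := by
  rw [← ENNReal.ofReal_inv_of_pos ht, ← ENNReal.ofReal_mul (inv_nonneg.2 ht.le),
    ← ENNReal.ofReal_mul hv.le]
  congr 1
  field_simp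

variable [IsProbabilityMeasure μ]

lemma ofReal_le_rivalBidLaw_Ioo (hv : 0 < v) (ht : 0 < t) (hx : x ≤ v * cdf μ t) (hβ : 0 ≤ β) :
    ENNReal.ofReal ((x - β) / t) ≤ rivalBidLaw μ v (Ioo β x) := by
  have hcdf : x / v ≤ cdf μ t := (div_le_iff₀' hv).2 hx
  have hsub : Ioo (β / v) (x / v) ⊆ Ioo 0 1 :=
    Ioo_subset_Ioo (div_nonneg hβ hv.le) (hcdf.trans (cdf_le_one μ t))
  rw [rivalBidLaw_apply measurableSet_Ioo, preimage_const_mul_Ioo₀ _ _ hv,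
    inter_eq_left.2 hsub]
  refine le_add_left ?_
  calc ENNReal.ofReal ((x - β) / t)
      = ENNReal.ofReal v * ∫⁻ _ in Ioo (β / v) (x / v), (ENNReal.ofReal t)⁻¹ := by
        rw [setLIntegral_const, Real.volume_Ioo, ofReal_mul_ofReal_inv_mul_div_sub_div hv ht]
    _ ≤ ENNReal.ofReal v * ∫⁻ u in Ioo (β / v) (x / v), (ENNReal.ofReal (quantile μ u))⁻¹ := by
        gcongr 1
        refine setLIntegral_mono' measurableSet_Ioo fun u hu => ?_
        gcongr
        exact (quantile_le_iff (hsub hu)).2 (hu.2.le.trans hcdf)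

lemma rivalBidLaw_Icc_le_ofReal (hv : 0 < v) (ht : 0 < t) (hx : 0 < x)
    (htx : v * μ.real (Iio t) ≤ x) :
    rivalBidLaw μ v (Icc x β) ≤ ENNReal.ofReal ((β - x) / t) := by
  have hle : ∀ᵐ u, u ∈ Icc (x / v) (β / v) ∩ Ioo 0 1 →
      (ENNReal.ofReal (quantile μ u))⁻¹ ≤ (ENNReal.ofReal t)⁻¹ := by
    filter_upwards [compl_mem_ae_iff.2 (measure_singleton (μ := volume) (x / v))] with u hne hu
    gcongr
    exact le_quantile hu.2
      (((le_div_iff₀' hv).2 htx).trans_lt (lt_of_le_of_ne hu.1.1 (Ne.symm hne)))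
  rw [rivalBidLaw_apply measurableSet_Icc, indicator_of_notMem fun h => hx.not_ge h.1, mul_zero,
    zero_add, preimage_const_mul_Icc₀ _ _ hv]
  calc ENNReal.ofReal v *
        ∫⁻ u in Icc (x / v) (β / v) ∩ Ioo 0 1, (ENNReal.ofReal (quantile μ u))⁻¹
      ≤ ENNReal.ofReal v * ∫⁻ _ in Icc (x / v) (β / v) ∩ Ioo 0 1, (ENNReal.ofReal t)⁻¹ := by
        gcongr 1
        exact setLIntegral_mono_ae' (measurableSet_Icc.inter measurableSet_Ioo) hle
    _ ≤ ENNReal.ofReal v * ∫⁻ _ in Icc (x / v) (β / v), (ENNReal.ofReal t)⁻¹ := by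
        gcongr 1
        exact lintegral_mono_set inter_subset_left
    _ = ENNReal.ofReal ((β - x) / t) := by
        rw [setLIntegral_const, Real.volume_Icc, ofReal_mul_ofReal_inv_mul_div_sub_div hv ht]

end RivalBidLaw

section Equilibrium

variable {μ : Measure ℝ} [IsProbabilityMeasure μ] {τ : Measure (ℝ × ℝ)} [IsProbabilityMeasure τ]
  {v : ℝ}

lemma bidPayoff_le_of_map_snd_eq_rivalBidLaw (hτ : τ.map Prod.snd = rivalBidLaw μ v) (hv : 0 < v)
    {t x β : ℝ} (ht : 0 < t) (hx : 0 < x) (htx : x ∈ Icc (v * μ.real (Iio t)) (v * cdf μ t))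
    (hβ : 0 ≤ β) : bidPayoff τ t β ≤ bidPayoff τ t x := by
  have := Measure.isProbabilityMeasure_map (μ := τ) measurable_snd.aemeasurable
  unfold bidPayoff
  rcases lt_or_ge β x with hlt | hle
  · have hgain : (x - β) / t ≤ winProb τ x - winProb τ β := by
      refine le_trans ?_ (real_Ioo_le_winProb_sub hlt)
      refine (ENNReal.ofReal_le_iff_le_toReal (measure_ne_top _ _)).1 ?_
      exact hτ ▸ ofReal_le_rivalBidLaw_Ioo hv ht htx.2 hβ
    linarith [(div_le_iff₀' ht).1 hgain]
  · have hgain : winProb τ β - winProb τ x ≤ (β - x) / t := by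
      refine (winProb_sub_le_real_Icc hle).trans ?_
      refine ENNReal.toReal_le_of_le_ofReal (div_nonneg (sub_nonneg.2 hle) ht.le) ?_
      exact hτ ▸ rivalBidLaw_Icc_le_ofReal hv ht hx htx.1
    linarith [(le_div_iff₀' ht).1 hgain]

lemma isBestResponse_quantileStrategy (hτ : τ.map Prod.snd = rivalBidLaw μ v) (hv : 0 < v)
    (hI : invQuantileIntegral μ ≠ ∞) : IsBestResponse μ (quantileStrategy μ v) τ where
  isProb := inferInstance
  marginal := map_fst_quantileStrategy μ v
  bid_nonneg := (ae_quantileStrategy_bid_mem hv).mono fun _ hp => hp.1.le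
  optimal := by
    have htype : ∀ᵐ p ∂quantileStrategy μ v, 0 < p.1 := by
      refine ae_of_ae_map measurable_fst.aemeasurable ?_
      rw [map_fst_quantileStrategy]
      exact ae_pos_of_invQuantileIntegral_ne_top hI
    filter_upwards [htype, ae_quantileStrategy_bid_mem hv] with p ht hp β hβ
    exact bidPayoff_le_of_map_snd_eq_rivalBidLaw hτ hv ht hp.1 hp.2 hβ

lemma isBestResponse_dirac_prod {G : Measure ℝ} [IsProbabilityMeasure G]
    (hG : ∀ᵐ x ∂G, x ∈ Icc 0 v) (hv : 0 < v) :
    IsBestResponse (Measure.dirac v) ((Measure.dirac v).prod G) (quantileStrategy μ v) := by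
  have hfst : ((Measure.dirac v).prod G).map Prod.fst = Measure.dirac v := by
    rw [Measure.map_fst_prod, measure_univ, one_smul]
  have htype : ∀ᵐ p ∂(Measure.dirac v).prod G, p.1 = v := by
    refine ae_of_ae_map (p := fun t => t = v) measurable_fst.aemeasurable ?_
    rw [hfst, ae_dirac_eq]
    exact Filter.eventually_pure.2 rfl
  have hbid : ∀ᵐ p ∂(Measure.dirac v).prod G, p.2 ∈ Icc 0 v := by
    refine ae_of_ae_map measurable_snd.aemeasurable ?_
    rwa [Measure.map_snd_prod, measure_univ, one_smul]
  refine ⟨inferInstance, hfst, hbid.mono fun p hp => hp.1, ?_⟩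
  filter_upwards [htype, hbid] with p hpv hp β hβ
  rw [bidPayoff, bidPayoff, hpv, mul_winProb_quantileStrategy hv hp, sub_self]
  exact sub_nonpos.2 (mul_winProb_quantileStrategy_le hv hβ)

lemma isBNE_quantileStrategy (hv : 0 < v) (hI : ENNReal.ofReal v * invQuantileIntegral μ ≤ 1) :
    IsBNE μ (Measure.dirac v) (quantileStrategy μ v)
      ((Measure.dirac v).prod (rivalBidLaw μ v)) := by
  have := isProbabilityMeasure_rivalBidLaw hI
  refine ⟨isBestResponse_quantileStrategy ?_ hv ?_,
    isBestResponse_dirac_prod (ae_rivalBidLaw_mem_Icc hv.le) hv⟩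
  · rw [Measure.map_snd_prod, measure_univ, one_smul]
  · exact (ENNReal.lt_top_of_mul_ne_top_right (ne_top_of_le_ne_top ENNReal.one_ne_top hI)
      (ENNReal.ofReal_pos.2 hv).ne').ne

end Equilibrium

/-- Every type of player 1 offers `0`, every bribe is accepted, a bribe reveals nothing about
player 1, and a rejection is attributed to the type `v` of player 2. -/
noncomputable def peacefulAssessment (μ : Measure ℝ) (v : ℝ) : Assessment where
  bribe _ := 0
  reject _ := ∅
  belief₁ _ := μ
  belief₂ _ := Measure.dirac v
  bid₁ _ := quantileStrategy μ v
  bid₂ _ := (Measure.dirac v).prod (rivalBidLaw μ v)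

lemma isPeaceful_peacefulAssessment (μ₁ μ₂ : Measure ℝ) (v : ℝ) :
    (peacefulAssessment μ₁ v).IsPeaceful μ₁ μ₂ :=
  Filter.Eventually.of_forall fun _ => measure_empty

lemma isEquilibrium_peacefulAssessment {μ₁ μ₂ : Measure ℝ} [IsProbabilityMeasure μ₁]
    {lo₁ hi₁ lo₂ v : ℝ} (h₁ : μ₁.support ⊆ Icc lo₁ hi₁) (hlo₂ : lo₂ ≤ v) (hv : 0 < v)
    (hI : ENNReal.ofReal v * invQuantileIntegral μ₁ ≤ 1) :
    (peacefulAssessment μ₁ v).IsEquilibrium μ₁ μ₂ lo₁ hi₁ lo₂ v := by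
  have hprob : IsProbabilityMeasure μ₁ ∧ μ₁ (Icc lo₁ hi₁) = 1 :=
    ⟨inferInstance, (mem_ae_iff_prob_eq_one measurableSet_Icc).1
      (Filter.mem_of_superset Measure.support_mem_ae h₁)⟩
  exact
  { bribe_measurable := measurable_const
    bribe_nonneg := fun _ _ => le_rfl
    reject_measurable := fun _ _ => MeasurableSet.empty
    belief₁_prob := fun _ _ => hprob
    belief₁_bayes := by
      change ∀ᵐ b ∂μ₁.map (fun _ => 0), μ₁ = condDistrib id (fun _ => (0 : ℝ)) μ₁ b
      rw [Measure.map_const, measure_univ, one_smul, ae_dirac_eq]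
      refine Filter.eventually_pure.2 (Eq.symm ?_)
      exact (condDistrib_eq_map_of_ae_eq_const aemeasurable_id (ae_eq_refl _)).trans Measure.map_id
    belief₁_sender := fun _ _ => (congrArg μ₁ (Set.ext fun _ => and_iff_left rfl)).trans hprob.2
    belief₂_prob := fun _ _ =>
      ⟨Measure.dirac.isProbabilityMeasure, Measure.dirac_apply_of_mem (right_mem_Icc.2 hlo₂)⟩
    belief₂_bayes := fun _ _ hrej => absurd measure_empty hrej
    auction := fun _ _ => isBNE_quantileStrategy (μ := μ₁) hv hI
    reject_optimal := fun _ _ _ _ hrej => absurd hrej (notMem_empty _)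
    accept_optimal := fun _ hb _ hw _ => (auctionValue_quantileStrategy_nonpos hv hw.2).trans hb
    bribe_optimal := fun v₁ _ b hb => by
      rw [Assessment.payoff₁_of_reject_null measure_empty,
        Assessment.payoff₁_of_reject_null measure_empty]
      exact sub_le_sub_left hb v₁ }

end Bribing

theorem mainTheorem7_general (μ₁ μ₂ : Measure ℝ) [IsProbabilityMeasure μ₁]
    [IsProbabilityMeasure μ₂] (lo₁ hi₁ lo₂ hi₂ : ℝ)
    (h₁ : μ₁.support ⊆ Icc lo₁ hi₁) (hlo₁ : lo₁ ∈ μ₁.support)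
    (h₂ : μ₂.support ⊆ Icc lo₂ hi₂) (hhi₂ : hi₂ ∈ μ₂.support) (hpos : 0 < hi₂) :
    (ENNReal.ofReal hi₂ * Bribing.invQuantileIntegral μ₁ ≤ 1 →
      Bribing.PeaceImplementable μ₁ μ₂ lo₁ hi₁ lo₂ hi₂ ∧
      ∃ A : Bribing.Assessment, A.IsEquilibrium μ₁ μ₂ lo₁ hi₁ lo₂ hi₂ ∧ A.IsPeaceful μ₁ μ₂ ∧
        (∀ v₁ ∈ Icc lo₁ hi₁, A.bribe v₁ = 0) ∧
        (∀ v₂ ∈ Icc lo₂ hi₂, v₂ ∉ A.reject 0)) ∧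
    (1 < ENNReal.ofReal hi₂ * Bribing.invQuantileIntegral μ₁ → lo₁ = 0 →
      ¬ Bribing.PeaceImplementable μ₁ μ₂ lo₁ hi₁ lo₂ hi₂) := by
  constructor
  · intro hI
    have hE := Bribing.isEquilibrium_peacefulAssessment (μ₂ := μ₂) h₁ (h₂ hhi₂).1 hpos hI
    have hP := Bribing.isPeaceful_peacefulAssessment μ₁ μ₂ hi₂
    exact ⟨⟨_, hE, hP⟩, _, hE, hP, fun _ _ => rfl, fun v₂ _ => notMem_empty v₂⟩
  · rintro hI rfl hP
    exact hI.not_ge (hP.mul_invQuantileIntegral_le_one h₁ hlo₁ h₂ hhi₂ hpos.le)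

theorem mainTheorem7 (μ₁ μ₂ : MeasureTheory.Measure ℝ)
    [MeasureTheory.IsProbabilityMeasure μ₁] [MeasureTheory.IsProbabilityMeasure μ₂]
    (lo₁ hi₁ lo₂ hi₂ : ℝ)
    (h₁ : Bribing.IsPrior μ₁ lo₁ hi₁) (h₂ : Bribing.IsPrior μ₂ lo₂ hi₂) :
    (ENNReal.ofReal hi₂ * Bribing.invQuantileIntegral μ₁ ≤ 1 →
      Bribing.PeaceImplementable μ₁ μ₂ lo₁ hi₁ lo₂ hi₂ ∧
      ∃ A : Bribing.Assessment, A.IsEquilibrium μ₁ μ₂ lo₁ hi₁ lo₂ hi₂ ∧ A.IsPeaceful μ₁ μ₂ ∧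
        (∀ v₁ ∈ Set.Icc lo₁ hi₁, A.bribe v₁ = 0) ∧
        (∀ v₂ ∈ Set.Icc lo₂ hi₂, v₂ ∉ A.reject 0)) ∧
    (1 < ENNReal.ofReal hi₂ * Bribing.invQuantileIntegral μ₁ → lo₁ = 0 →
      ¬ Bribing.PeaceImplementable μ₁ μ₂ lo₁ hi₁ lo₂ hi₂) := by
  exact mainTheorem7_general μ₁ μ₂ lo₁ hi₁ lo₂ hi₂ h₁.support_eq.subset
    (h₁.support_eq ▸ left_mem_Icc.2 h₁.lt.le) h₂.support_eq.subset
    (h₂.support_eq ▸ right_mem_Icc.2 h₂.lt.le) (h₂.nonneg.trans_lt h₂.lt)
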